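/- Let $X$ be a real Banach space such that the norm of $X$ and the dual norm of $X^{*}$ are both Fréchet differentiable (at every nonzero point). Then $X$ is reflexive, $X$ is smooth (for every $x\neq 0$ there is exactly one $f\in X^{*}$ with $\|f\|=1$ and $f(x)=\|x\|$), and $X^{*}$ is strictly convex. Moreover, let $K\subseteq X$ be a Čebyšev set, that is, for every $x\in X$ there is exactly one $\overline{x}\in K$ with $\|x-\overline{x}\|=d_{K}(x)$, where $d_{K}(x)=\inf\{\|x-v\|: v\in K\}$. If $d_{K}$ is Gateaux differentiable at every $x\in X\setminus K$, that is, for each such $x$ there is $A\in X^{*}$ with $\lim_{t\to 0}\frac{d_{K}(x+ty)-d_{K}(x)}{t}=A(y)$ for all $y\in X$, then $K$ is convex. -/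

import Mathlib

open Set Filter Topology

/-- The norm of `E` is Fréchet differentiable (at every nonzero point). -/
def FrechetDifferentiableNorm (E : Type*) [NormedAddCommGroup E] [NormedSpace ℝ E] : Prop :=
  ∀ x : E, x ≠ 0 → DifferentiableAt ℝ (fun y : E => ‖y‖) x

/-- `E` is reflexive: the canonical embedding of `E` into its bidual is onto. -/
def IsReflexiveSpace (E : Type*) [NormedAddCommGroup E] [NormedSpace ℝ E] : Prop :=
  Function.Surjective (NormedSpace.inclusionInDoubleDual ℝ E)

/-- `E` is smooth: every nonzero point has exactly one norming functional of norm one. -/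
def IsSmoothSpace (E : Type*) [NormedAddCommGroup E] [NormedSpace ℝ E] : Prop :=
  ∀ x : E, x ≠ 0 → ∃! f : StrongDual ℝ E, ‖f‖ = 1 ∧ f x = ‖x‖

/-- `K` is a Čebyšev set: every point of the space has exactly one nearest point in `K`
(so in particular `K` is nonempty). -/
def IsChebyshevSet {E : Type*} [NormedAddCommGroup E] (K : Set E) : Prop :=
  ∀ x : E, ∃! y : E, y ∈ K ∧ ‖x - y‖ = Metric.infDist x K

/-- `f` is Gateaux differentiable at `x`: the two-sided directional derivatives of `f` at `x`
exist in all directions and are given by a continuous linear functional. -/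
def GateauxDifferentiableAt {E : Type*} [NormedAddCommGroup E] [NormedSpace ℝ E]
    (f : E → ℝ) (x : E) : Prop :=
  ∃ A : StrongDual ℝ E, ∀ y : E,
    Tendsto (fun t : ℝ => (f (x + t • y) - f x) / t) (𝓝[≠] 0) (𝓝 (A y))

/-!
Ekeland's variational principle carries both halves of the argument.

*Reflexivity.* Write `J : X → X**` for the canonical embedding. If the dual norm is Fréchet
differentiable at `f`, Šmulian's argument shows that `J x` approaches its derivative as soon as
`‖x‖ ≤ 1` and `f x` approaches `‖f‖`, so the derivative lies in the closed subspace `J(X)`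
(`fderiv_norm_dual_mem_closure_range`). Given `Φ ∈ X**`, the function `‖g‖² / 2 - Φ g` is bounded
below on `X*`; at an Ekeland point its derivative is small, and that derivative is an element of
`J(X)` minus `Φ`. Hence `J(X)` is dense in `X**`, and being closed it is everything. Smoothness holds
because a norming functional of norm one at `x` must be the derivative of the norm at `x`. If
`‖f‖ = ‖g‖ = 1` and `‖f + g‖ = 2`, then by reflexivity `f + g` attains its norm, at a point where
`f` and `g` are both norming, so `f = g` by smoothness; thus `X*` is strictly convex.

*Chebyshev sets.* This is Vlasov's method. Let `x ∉ K` have nearest point `p`. Along the segment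
from `x` to `p` the distance `d_K` decreases at unit speed; as its directional derivatives are
two-sided, it increases at unit speed when `x` moves away from `p` (`exists_infDist_add_mul_lt`).
Ekeland's principle on a closed unit ball turns this infinitesimal growth into growth by
almost `1` over distance `1` (`exists_infDist_gt_add_one`). Iterating from a hypothetical
`c ∉ K` between points `a`, `b` of `K` gives nested balls disjoint from `K`, the `n`-th of radius
`β + n` and with center within `n` of `c`. Their union is convex and open; separating it from `a`
and from `b` gives norm-one functionals which are both almost norming at the centers, hence have a
sum of norm `2` and coincide by strict convexity of `X*`. A single functional then separates both `a`
and `b` strictly from `c`, which is impossible (`convex_of_forall_exists_infDist_gt`).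
-/

/-! ### Ekeland's variational principle -/

/-- **Ekeland's variational principle**: a lower semicontinuous function bounded below on a complete
metric space admits a point `z` that is the strict minimum of `w ↦ φ w + ε * dist z w`, and `z` can be
taken below the cone of slope `ε` hanging from a given point `x₀`. -/
theorem exists_ekeland_point {α : Type*} [MetricSpace α] [CompleteSpace α] {φ : α → ℝ}
    (hφ : LowerSemicontinuous φ) (hbdd : BddBelow (range φ)) {ε : ℝ} (hε : 0 < ε) (x₀ : α) :
    ∃ z, φ z + ε * dist x₀ z ≤ φ x₀ ∧ ∀ w, φ w + ε * dist z w ≤ φ z → w = z := by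
  -- The points below the cone of slope `ε` with apex at `x`; this relation is transitive.
  set S : α → Set α := fun x => {w | φ w + ε * dist x w ≤ φ x} with hS
  have hself : ∀ x, x ∈ S x := fun x => by simp [hS]
  have htrans : ∀ {x y w}, y ∈ S x → w ∈ S y → w ∈ S x := by
    intro x y w hy hw
    change φ y + ε * dist x y ≤ φ x at hy
    change φ w + ε * dist y w ≤ φ y at hw
    change φ w + ε * dist x w ≤ φ x
    nlinarith [dist_triangle x y w]
  have hclosed : ∀ x, IsClosed (S x) := fun x => by
    have hlsc : LowerSemicontinuous fun w => φ w + ε * dist x w :=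
      hφ.add (Continuous.lowerSemicontinuous (by fun_prop))
    exact hlsc.isClosed_preimage (φ x)
  -- Almost minimizing `φ` on `S x` makes the next set `S y` small.
  have hstep : ∀ (n : ℕ) (x : α), ∃ y ∈ S x, ∀ w ∈ S x, φ y ≤ φ w + ε * (1 / 2) ^ n := by
    intro n x
    obtain ⟨-, ⟨y, hy, rfl⟩, hlt⟩ := Real.lt_sInf_add_pos
      (s := φ '' S x) ⟨φ x, x, hself x, rfl⟩ (ε := ε * (1 / 2) ^ n) (by positivity)
    refine ⟨y, hy, fun w hw => ?_⟩
    have := csInf_le (hbdd.mono (image_subset_range φ (S x))) ⟨w, hw, rfl⟩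
    linarith
  choose g hgS hgmin using hstep
  let u : ℕ → α := fun n => Nat.rec x₀ (fun k x => g k x) n
  have hu : ∀ n, u (n + 1) = g n (u n) := fun n => rfl
  have huS : ∀ n k, u (n + k) ∈ S (u n) := by
    intro n k
    induction k with
    | zero => exact hself _
    | succ k ih => exact htrans ih (hgS _ _)
  have hdist : ∀ n w, w ∈ S (u (n + 1)) → dist (u (n + 1)) w ≤ 1 * (1 / 2) ^ n := by
    intro n w hw
    have h1 := hgmin n (u n) w (htrans (huS n 1) hw)
    rw [← hu] at h1
    have h2 : φ w + ε * dist (u (n + 1)) w ≤ φ (u (n + 1)) := hw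
    have h3 : ε * dist (u (n + 1)) w ≤ ε * (1 / 2) ^ n := by linarith
    rw [one_mul]
    exact le_of_mul_le_mul_left h3 hε
  obtain ⟨z, hz⟩ := cauchySeq_tendsto_of_complete
    (cauchySeq_of_le_geometric (f := fun n => u (n + 1)) (1 / 2) 1 (by norm_num)
      fun n => hdist n _ (huS (n + 1) 1))
  have hz' : Tendsto u atTop (𝓝 z) := (tendsto_add_atTop_iff_nat 1).1 hz
  have hzS : ∀ n, z ∈ S (u n) := fun n => (hclosed _).mem_of_tendsto
    ((tendsto_add_atTop_iff_nat n).2 hz')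
    (Eventually.of_forall fun k => by rw [add_comm]; exact huS n k)
  refine ⟨z, hzS 0, fun w hw => ?_⟩
  have hw' : Tendsto (fun n => u (n + 1)) atTop (𝓝 w) := by
    rw [tendsto_iff_dist_tendsto_zero]
    refine squeeze_zero (fun _ => dist_nonneg) (fun n => hdist n w (htrans (hzS (n + 1)) hw)) ?_
    simpa using tendsto_pow_atTop_nhds_zero_of_lt_one (r := (1 / 2 : ℝ)) (by norm_num) (by norm_num)
  exact tendsto_nhds_unique hw' hz

/-- First-order condition at a minimum of a function perturbed by a cone of slope `ε`. -/
theorem norm_fderiv_le_of_forall_le_add {E : Type*} [NormedAddCommGroup E] [NormedSpace ℝ E]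
    {φ : E → ℝ} {φ' : StrongDual ℝ E} {z : E} (hφ : HasFDerivAt φ φ' z) {ε : ℝ} (hε : 0 ≤ ε)
    (hz : ∀ w, φ z ≤ φ w + ε * ‖w - z‖) : ‖φ'‖ ≤ ε := by
  refine le_of_forall_pos_le_add fun η hη =>
    ContinuousLinearMap.opNorm_le_of_nhds_zero (by positivity) ?_
  have hright : ∀ᶠ h in 𝓝 (0 : E), -φ' h ≤ (ε + η) * ‖h‖ := by
    filter_upwards [(hasFDerivAt_iff_isLittleO_nhds_zero.1 hφ).bound hη] with h hh
    have h1 := hz (z + h)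
    rw [add_sub_cancel_left] at h1
    rw [Real.norm_eq_abs] at hh
    have := le_abs_self (φ (z + h) - φ z - φ' h)
    linarith
  have hleft : ∀ᶠ h in 𝓝 (0 : E), -φ' (-h) ≤ (ε + η) * ‖-h‖ :=
    (continuous_neg.tendsto' (0 : E) 0 neg_zero).eventually hright
  filter_upwards [hright, hleft] with h h1 h2
  rw [map_neg, neg_neg, norm_neg] at h2
  rw [Real.norm_eq_abs]
  exact abs_le.2 ⟨by linarith, h2⟩

/-! ### Reflexivity from differentiability of the dual norm -/

theorem exists_norm_lt_one_lt_apply {X : Type*} [NormedAddCommGroup X] [NormedSpace ℝ X]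
    (f : StrongDual ℝ X) {r : ℝ} (hr : r < ‖f‖) : ∃ x : X, ‖x‖ < 1 ∧ r < f x := by
  obtain ⟨x, hx, hlt⟩ := f.exists_lt_apply_of_lt_opNorm hr
  rw [Real.norm_eq_abs] at hlt
  rcases le_total 0 (f x) with h | h
  · exact ⟨x, hx, by rwa [abs_of_nonneg h] at hlt⟩
  · exact ⟨-x, by rwa [norm_neg], by rwa [abs_of_nonpos h, ← map_neg] at hlt⟩

/-- One half of Šmulian's theorem: where the dual norm is Fréchet differentiable, its derivative is a
norm limit of evaluations at points of the unit ball at which the functional almost attains its norm. -/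
theorem fderiv_norm_dual_mem_closure_range {X : Type*} [NormedAddCommGroup X] [NormedSpace ℝ X]
    {f : StrongDual ℝ X} {D : StrongDual ℝ (StrongDual ℝ X)}
    (hD : HasFDerivAt (fun g : StrongDual ℝ X => ‖g‖) D f) :
    D ∈ closure (range (NormedSpace.inclusionInDoubleDual ℝ X)) := by
  refine (Metric.mem_closure_range_iff (α := StrongDual ℝ (StrongDual ℝ X))).2 fun ε hε => ?_
  obtain ⟨δ, hδ, hball⟩ := Metric.eventually_nhds_iff.1
    ((hasFDerivAt_iff_isLittleO_nhds_zero.1 hD).bound (show 0 < ε / 8 by positivity))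
  obtain ⟨x, hx, hfx⟩ := exists_norm_lt_one_lt_apply f
    (show ‖f‖ - ε * δ / 8 < ‖f‖ by have := mul_pos hε hδ; linarith)
  refine ⟨x, ?_⟩
  -- Compare `(f + h) x ≤ ‖f + h‖` with the first-order expansion of the norm at `f`. The defect
  -- `‖f‖ - f x` was chosen of order `ε * δ`, hence negligible when `‖h‖` is comparable to `δ`.
  have hkey : ∀ h : StrongDual ℝ X, ‖h‖ < δ → h x - D h ≤ ε * δ / 8 + ε / 8 * ‖h‖ := by
    intro h hh
    have h1 := hball (y := h) (by simpa using hh)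
    rw [Real.norm_eq_abs] at h1
    have h2 := le_abs_self (‖f + h‖ - ‖f‖ - D h)
    have h3 : (f + h) x ≤ ‖f + h‖ :=
      (le_abs_self _).trans ((f + h).unit_le_opNorm x hx.le)
    rw [add_apply] at h3
    linarith
  have hnorm : ‖D - NormedSpace.inclusionInDoubleDual ℝ X x‖ ≤ ε / 2 := by
    refine ContinuousLinearMap.opNorm_le_of_shell (ε := δ) (c := (2 : ℝ)) hδ (by positivity)
      (by norm_num) fun h hlow hh => ?_
    have h1 := hkey h hh
    have h2 := hkey (-h) (by simpa using hh)
    rw [norm_neg, map_neg, neg_apply] at h2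
    rw [Real.norm_ofNat] at hlow
    have h3 : ε * δ ≤ ε * (2 * ‖h‖) := by gcongr; linarith
    rw [sub_apply, NormedSpace.dual_def, Real.norm_eq_abs]
    have := mul_nonneg hε.le (norm_nonneg h)
    exact abs_le.2 ⟨by linarith, by linarith⟩
  exact (dist_eq_norm (E := StrongDual ℝ (StrongDual ℝ X)) _ _).trans_lt (by linarith)

theorem isReflexiveSpace_of_frechetDifferentiableNorm_dual {X : Type*} [NormedAddCommGroup X]
    [NormedSpace ℝ X] [CompleteSpace X] (hX' : FrechetDifferentiableNorm (StrongDual ℝ X)) :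
    IsReflexiveSpace X := by
  set J := NormedSpace.inclusionInDoubleDual ℝ X
  have hclosed : IsClosed (range J) :=
    (Isometry.isClosedEmbedding (γ := StrongDual ℝ (StrongDual ℝ X))
      (NormedSpace.inclusionInDoubleDualLi (E := X) ℝ).isometry).isClosed_range
  intro Φ
  change Φ ∈ range J
  rw [← hclosed.closure_eq]
  refine (Metric.mem_closure_range_iff (α := StrongDual ℝ (StrongDual ℝ X))).2 fun ε hε => ?_
  set φ : StrongDual ℝ X → ℝ := fun g => ‖g‖ ^ 2 / 2 - Φ g with hφ
  have hbdd : BddBelow (range φ) := by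
    refine ⟨-(‖Φ‖ ^ 2 / 2), ?_⟩
    rintro _ ⟨g, rfl⟩
    have := (le_abs_self _).trans (Φ.le_opNorm g)
    simp only [hφ]
    nlinarith [sq_nonneg (‖Φ‖ - ‖g‖)]
  obtain ⟨z, -, hz⟩ := exists_ekeland_point
    (Continuous.lowerSemicontinuous (f := φ) (by fun_prop)) hbdd (half_pos hε) 0
  have hmin : ∀ w, φ z ≤ φ w + ε / 2 * ‖w - z‖ := by
    intro w
    by_contra! h
    rw [← dist_eq_norm, dist_comm] at h
    have := hz w h.le
    subst this
    simp at h
  -- The derivative of `‖·‖² / 2` exists at every point, the origin included, and lies in `range J`.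
  obtain ⟨x, hx⟩ : ∃ x, HasFDerivAt (fun g : StrongDual ℝ X => ‖g‖ ^ 2 / 2) (J x) z := by
    by_cases h0 : z = 0
    · refine ⟨0, ?_⟩
      subst h0
      rw [map_zero, hasFDerivAt_iff_isLittleO_nhds_zero]
      simp only [zero_add, norm_zero, zero_apply, sub_zero]
      refine Asymptotics.IsLittleO.congr_left (f₁ := fun h : StrongDual ℝ X => (1 / 2) * ‖h‖ ^ 2)
        ((Asymptotics.isLittleO_norm_pow_id one_lt_two).const_mul_left _) fun h => by ring
    · obtain ⟨x, hx⟩ : fderiv ℝ (fun g : StrongDual ℝ X => ‖g‖) z ∈ range J := by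
        rw [← hclosed.closure_eq]
        exact fderiv_norm_dual_mem_closure_range (hX' z h0).hasFDerivAt
      refine ⟨‖z‖ • x, ?_⟩
      have h1 := ((hX' z h0).hasFDerivAt.pow 2).mul_const (1 / 2 : ℝ)
      rw [← hx] at h1
      have heq : (1 / 2 : ℝ) • (2 • ‖z‖ ^ (2 - 1)) • J x = J (‖z‖ • x) := by
        ext g
        simp
        ring
      rw [heq] at h1
      exact h1.congr_of_eventuallyEq (Eventually.of_forall fun g => div_eq_mul_one_div _ _)
  refine ⟨x, ?_⟩
  have := norm_fderiv_le_of_forall_le_add (hx.sub Φ.hasFDerivAt) (half_pos hε).le hmin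
  rw [norm_sub_rev] at this
  exact (dist_eq_norm (E := StrongDual ℝ (StrongDual ℝ X)) _ _).trans_lt (by linarith)

/-! ### Smoothness, and strict convexity of the dual -/

/-- Norming functionals of norm one are unique because each of them is the derivative of the norm. -/
theorem isSmoothSpace_of_frechetDifferentiableNorm {X : Type*} [NormedAddCommGroup X]
    [NormedSpace ℝ X] (hX : FrechetDifferentiableNorm X) : IsSmoothSpace X := by
  intro x hx
  -- `‖y‖ - f y ≥ 0` with equality at `x`, so its derivative vanishes there.
  have huniq : ∀ f : StrongDual ℝ X, ‖f‖ = 1 ∧ f x = ‖x‖ → f = fderiv ℝ (fun y : X => ‖y‖) x := by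
    rintro f ⟨hf, hfx⟩
    have hmin : IsLocalMin (fun y => ‖y‖ - f y) x := Eventually.of_forall fun y => by
      have := (le_abs_self _).trans (f.le_opNorm y)
      rw [hf, one_mul] at this
      simp only [hfx, sub_self]
      linarith
    exact (sub_eq_zero.1 (hmin.hasFDerivAt_eq_zero ((hX x hx).hasFDerivAt.sub f.hasFDerivAt))).symm
  obtain ⟨f, hf⟩ := exists_dual_vector ℝ x (norm_ne_zero_iff.2 hx)
  exact ⟨f, hf, fun g hg => (huniq g hg).trans (huniq f hf).symm⟩

theorem IsReflexiveSpace.exists_norm_le_one_apply_eq {X : Type*} [NormedAddCommGroup X]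
    [NormedSpace ℝ X] (hR : IsReflexiveSpace X) (f : StrongDual ℝ X) :
    ∃ x : X, ‖x‖ ≤ 1 ∧ f x = ‖f‖ := by
  obtain ⟨Φ, hΦ, hΦf⟩ := exists_dual_vector'' ℝ f
  obtain ⟨x, rfl⟩ := hR Φ
  refine ⟨x, ?_, by simpa using hΦf⟩
  rw [← (NormedSpace.inclusionInDoubleDualLi (E := X) ℝ).norm_map x]
  exact hΦ

theorem IsSmoothSpace.strictConvexSpace_dual {X : Type*} [NormedAddCommGroup X]
    [NormedSpace ℝ X] (hS : IsSmoothSpace X) (hR : IsReflexiveSpace X) :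
    StrictConvexSpace ℝ (StrongDual ℝ X) := by
  refine StrictConvexSpace.of_norm_add_ne_two fun f g hf hg hne h2 => hne ?_
  obtain ⟨x, hx, hfgx⟩ := hR.exists_norm_le_one_apply_eq (f + g)
  rw [h2, add_apply] at hfgx
  have h1 : f x ≤ ‖x‖ := by simpa [hf] using (le_abs_self _).trans (f.le_opNorm x)
  have h3 : g x ≤ ‖x‖ := by simpa [hg] using (le_abs_self _).trans (g.le_opNorm x)
  have hx0 : x ≠ 0 := by
    rintro rfl
    simp at hfgx
  exact (hS x hx0).unique ⟨hf, by linarith⟩ ⟨hg, by linarith⟩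

/-! ### Convexity of Chebyshev sets -/

theorem IsChebyshevSet.infDist_pos_of_notMem {X : Type*} [NormedAddCommGroup X] {K : Set X}
    (hK : IsChebyshevSet K) {x : X} (hx : x ∉ K) : 0 < Metric.infDist x K := by
  obtain ⟨p, ⟨hp, hxp⟩, -⟩ := hK x
  rw [← hxp, norm_pos_iff, sub_ne_zero]
  rintro rfl
  exact hx hp

/-- Where it is Gateaux differentiable, the distance to a Chebyshev set grows at unit rate in the
direction pointing away from the nearest point. -/
theorem exists_infDist_add_mul_lt {X : Type*} [NormedAddCommGroup X] [NormedSpace ℝ X] {K : Set X}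
    (hK : IsChebyshevSet K) {x : X} (hx : x ∉ K)
    (hd : GateauxDifferentiableAt (fun z : X => Metric.infDist z K) x) {σ : ℝ} (hσ : σ < 1)
    {η : ℝ} (hη : 0 < η) :
    ∃ w, dist w x < η ∧ Metric.infDist x K + σ * dist x w < Metric.infDist w K := by
  have hpos := hK.infDist_pos_of_notMem hx
  obtain ⟨p, ⟨hp, hxp⟩, -⟩ := hK x
  set d := Metric.infDist x K
  obtain ⟨A, hA⟩ := hd
  -- Towards `p` the distance decreases at least linearly; linearity of `A` reverses the direction.
  have hApx : A (p - x) ≤ -d := by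
    refine le_of_tendsto ((hA (p - x)).mono_left (nhdsGT_le_nhdsNE 0)) ?_
    filter_upwards [Ioo_mem_nhdsGT (show (0 : ℝ) < 1 by norm_num)] with t ht
    have h1 : Metric.infDist (x + t • (p - x)) K ≤ (1 - t) * d := by
      refine (Metric.infDist_le_dist_of_mem hp).trans_eq ?_
      rw [dist_eq_norm, show x + t • (p - x) - p = (1 - t) • (x - p) by module, norm_smul, hxp,
        Real.norm_of_nonneg (by linarith [ht.2])]
    rw [div_le_iff₀ ht.1]
    linarith
  have hAxp : σ * d < A (x - p) := by
    rw [← neg_sub, map_neg]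
    nlinarith
  have hev := ((hA (x - p)).mono_left (nhdsGT_le_nhdsNE 0)).eventually (lt_mem_nhds hAxp)
  obtain ⟨t, hlt, ht0, htη⟩ := (hev.and (Ioo_mem_nhdsGT (div_pos hη hpos))).exists
  have hdist : dist (x + t • (x - p)) x = t * d := by
    rw [dist_eq_norm, add_sub_cancel_left, norm_smul, hxp, Real.norm_of_nonneg ht0.le]
  refine ⟨x + t • (x - p), ?_, ?_⟩
  · rwa [hdist, ← lt_div_iff₀ hpos]
  · rw [lt_div_iff₀ ht0] at hlt
    rw [dist_comm, hdist]
    linarith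

/-- Local growth of the distance function at every rate `σ < 1` integrates to growth over a unit
distance. In terms of balls: one of radius `r` at positive distance from `K` lies in a ball of
radius `r + 1` with the same property. -/
theorem exists_infDist_gt_add_one {X : Type*} [NormedAddCommGroup X] [CompleteSpace X] {K : Set X}
    (hgrow : ∀ x ∉ K, ∀ σ < (1 : ℝ), ∀ η > (0 : ℝ), ∃ w, dist w x < η ∧
      Metric.infDist x K + σ * dist x w < Metric.infDist w K)
    {x : X} {r : ℝ} (hr : 0 ≤ r) (hrx : r < Metric.infDist x K) :
    ∃ z, dist z x ≤ 1 ∧ r + 1 < Metric.infDist z K := by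
  set d := Metric.infDist x K
  obtain ⟨σ, hσ0, hσ1, hσ⟩ : ∃ σ : ℝ, 0 < σ ∧ σ < 1 ∧ r + 1 < d + σ :=
    ⟨max (1 / 2) (1 - (d - r) / 2), by positivity,
      max_lt (by norm_num) (by linarith),
      by linarith [le_max_right (1 / 2 : ℝ) (1 - (d - r) / 2)]⟩
  have : CompleteSpace (Metric.closedBall x 1) := Metric.isClosed_closedBall.completeSpace_coe
  have hbdd : BddBelow (range fun y : Metric.closedBall x 1 => -Metric.infDist (y : X) K) := by
    refine ⟨-(d + 1), ?_⟩
    rintro _ ⟨⟨y, hy⟩, rfl⟩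
    have h1 : dist y x ≤ 1 := hy
    have h2 : Metric.infDist y K ≤ d + dist y x := Metric.infDist_le_infDist_add_dist
    simp only
    linarith
  obtain ⟨⟨z, hzx⟩, hz, hzmax⟩ := exists_ekeland_point (Continuous.lowerSemicontinuous
    ((Metric.continuous_infDist_pt K).comp continuous_subtype_val).neg) hbdd hσ0
    (⟨x, by simp⟩ : Metric.closedBall x 1)
  have hz' : -Metric.infDist z K + σ * dist x z ≤ -d := hz
  rw [Metric.mem_closedBall] at hzx
  refine ⟨z, hzx, ?_⟩
  -- An Ekeland point inside the open ball would contradict the local growth.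
  have hzx1 : dist z x = 1 := by
    refine hzx.antisymm (not_lt.1 fun hlt => ?_)
    have hzK : z ∉ K := fun hmem => by
      have := Metric.infDist_zero_of_mem hmem
      have := mul_nonneg hσ0.le (dist_nonneg (x := x) (y := z))
      linarith
    obtain ⟨w, hwz, hw⟩ := hgrow z hzK σ hσ1 (1 - dist z x) (by linarith)
    have hwx : w ∈ Metric.closedBall x 1 := by
      rw [Metric.mem_closedBall]
      linarith [dist_triangle w z x]
    have heq := hzmax ⟨w, hwx⟩ (show -Metric.infDist w K + σ * dist z w ≤ -Metric.infDist z K by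
      linarith)
    have heq' : w = z := congrArg Subtype.val heq
    subst heq'
    simp at hw
  rw [dist_comm, hzx1] at hz'
  linarith

/-- Vlasov's theorem on sets whose complement is exhausted by growing balls: such a set is convex when
the dual space is strictly convex. -/
theorem convex_of_forall_exists_infDist_gt {X : Type*} [NormedAddCommGroup X] [NormedSpace ℝ X]
    [StrictConvexSpace ℝ (StrongDual ℝ X)] {K : Set X}
    (hpos : ∀ x ∉ K, 0 < Metric.infDist x K)
    (hstep : ∀ (x : X) (r : ℝ), 0 ≤ r → r < Metric.infDist x K →
      ∃ z, dist z x ≤ 1 ∧ r + 1 < Metric.infDist z K) :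
    Convex ℝ K := by
  rw [convex_iff_forall_pos]
  intro a ha b hb s t hs ht hst
  by_contra hc
  set c := s • a + t • b with hcdef
  obtain ⟨β, hβ, hβc⟩ := exists_between (hpos c hc)
  choose! g hg1 hg2 using hstep
  let u : ℕ → X := fun n => Nat.rec c (fun k x => g x (β + k)) n
  have hu : ∀ n, u (n + 1) = g (u n) (β + n) := fun n => rfl
  have hinf : ∀ n : ℕ, β + n < Metric.infDist (u n) K := by
    intro n
    induction n with
    | zero => simpa [u] using hβc
    | succ n ih =>
      have := hg2 (u n) (β + n) (by positivity) ih
      rw [hu]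
      push_cast
      linarith
  have hu1 : ∀ n, dist (u (n + 1)) (u n) ≤ 1 := fun n => hg1 _ _ (by positivity) (hinf n)
  have huc : ∀ n : ℕ, dist (u n) c ≤ n := by
    intro n
    induction n with
    | zero => simp [u]
    | succ n ih =>
      push_cast
      linarith [dist_triangle (u (n + 1)) (u n) c, hu1 n]
  -- The union of the nested balls is a convex open set disjoint from `K`.
  set U : Set X := ⋃ n : ℕ, Metric.ball (u n) (β + n) with hU
  have hmono : Monotone fun n : ℕ => Metric.ball (u n) (β + n) := by
    refine monotone_nat_of_le_succ fun n => Metric.ball_subset_ball' ?_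
    rw [dist_comm]
    push_cast
    linarith [hu1 n]
  have hUconv : Convex ℝ U :=
    hmono.directed_le.convex_iUnion fun n => convex_ball _ _
  have hUopen : IsOpen U := isOpen_iUnion fun n => Metric.isOpen_ball
  have hUK : ∀ y ∈ K, y ∉ U := by
    intro y hy hyU
    obtain ⟨n, hn⟩ := mem_iUnion.1 hyU
    rw [Metric.mem_ball, dist_comm] at hn
    linarith [Metric.infDist_le_dist_of_mem (x := u n) hy, hinf n]
  have hcU : c ∈ U := mem_iUnion.2 ⟨0, by simpa [u] using hβ⟩
  -- A norm-one functional bounded below by `f y` on the `n`-th ball is at least `f y + (β + n)` at its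
  -- center.
  have hsep : ∀ y ∈ K, ∃ f : StrongDual ℝ X, ‖f‖ = 1 ∧ (∀ v ∈ U, f y < f v) ∧
      ∀ n : ℕ, f y + (β + n) ≤ f (u n) := by
    intro y hy
    obtain ⟨f₀, hf₀⟩ := geometric_hahn_banach_point_open hUconv hUopen (hUK y hy)
    have hne : f₀ ≠ 0 := by
      rintro rfl
      simpa using hf₀ c hcU
    have hnpos : 0 < ‖f₀‖ := norm_pos_iff.2 hne
    set f := ‖f₀‖⁻¹ • f₀ with hf
    have hf1 : ‖f‖ = 1 := by rw [hf, norm_smul, norm_inv, norm_norm, inv_mul_cancel₀ hnpos.ne']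
    have hlt : ∀ v ∈ U, f y < f v := fun v hv => by
      simp only [hf, smul_apply, smul_eq_mul]
      exact mul_lt_mul_of_pos_left (hf₀ v hv) (inv_pos.2 hnpos)
    refine ⟨f, hf1, hlt, fun n => ?_⟩
    have hrn : 0 < β + n := by positivity
    by_contra! hcon
    obtain ⟨v, hv, hfv⟩ := exists_norm_lt_one_lt_apply f (r := (f (u n) - f y) / (β + n))
      (by rw [hf1, div_lt_one hrn]; linarith)
    have hmem : u n - (β + n) • v ∈ U := by
      refine mem_iUnion.2 ⟨n, ?_⟩
      rw [Metric.mem_ball, dist_eq_norm, sub_sub_cancel_left, norm_neg, norm_smul,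
        Real.norm_of_nonneg hrn.le]
      exact mul_lt_of_lt_one_right hrn hv
    have := hlt _ hmem
    rw [map_sub, map_smul, smul_eq_mul] at this
    rw [div_lt_iff₀ hrn] at hfv
    linarith
  obtain ⟨f, hf1, hfU, hfu⟩ := hsep a ha
  obtain ⟨h, hh1, hhU, hhu⟩ := hsep b hb
  -- Both functionals grow like `n` on the centers, whose norms are at most `n + ‖c‖`.
  have hsum : ‖f + h‖ = 2 := by
    refine le_antisymm ((norm_add_le f h).trans (by rw [hf1, hh1]; norm_num)) ?_
    by_contra! hlt2
    obtain ⟨n, hn⟩ := exists_nat_gt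
      ((‖f + h‖ * ‖c‖ - (f a + h b + 2 * β)) / (2 - ‖f + h‖))
    rw [div_lt_iff₀ (by linarith)] at hn
    have h1 : (f + h) (u n) ≤ ‖f + h‖ * ‖u n‖ := (le_abs_self _).trans ((f + h).le_opNorm _)
    have h2 : ‖u n‖ ≤ n + ‖c‖ := by
      have := norm_le_norm_sub_add (u n) c
      rw [← dist_eq_norm] at this
      linarith [huc n]
    have h3 : ‖f + h‖ * ‖u n‖ ≤ ‖f + h‖ * (n + ‖c‖) := by gcongr
    rw [add_apply] at h1
    linarith [hfu n, hhu n]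
  have hfh : f = h := eq_of_norm_eq_of_norm_add_eq (hf1.trans hh1.symm)
    (by rw [hsum, hf1, hh1]; norm_num)
  subst hfh
  have hfc : f c = s * f a + t * f b := by simp [hcdef]
  have h1 := mul_lt_mul_of_pos_left (hfU c hcU) hs
  have h2 := mul_lt_mul_of_pos_left (hhU c hcU) ht
  have h3 : s * f c + t * f c = f c := by rw [← add_mul, hst, one_mul]
  linarith

theorem mainTheorem4 {X : Type*} [NormedAddCommGroup X] [NormedSpace ℝ X] [CompleteSpace X]
    (hX : FrechetDifferentiableNorm X) (hX' : FrechetDifferentiableNorm (StrongDual ℝ X)) :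
    IsReflexiveSpace X ∧ IsSmoothSpace X ∧ StrictConvexSpace ℝ (StrongDual ℝ X) ∧
      ∀ K : Set X, IsChebyshevSet K →
        (∀ x : X, x ∉ K → GateauxDifferentiableAt (fun z : X => Metric.infDist z K) x) →
          Convex ℝ K := by
  have hR := isReflexiveSpace_of_frechetDifferentiableNorm_dual hX'
  have hS := isSmoothSpace_of_frechetDifferentiableNorm hX
  have hC := hS.strictConvexSpace_dual hR
  refine ⟨hR, hS, hC, fun K hK hd => ?_⟩
  exact convex_of_forall_exists_infDist_gt (fun x hx => hK.infDist_pos_of_notMem hx) fun x r hr hrx =>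
    exists_infDist_gt_add_one
      (fun y hy σ hσ η hη => exists_infDist_add_mul_lt hK hy (hd y hy) hσ hη) hr hrx
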